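/- Let $\mathfrak M$ be a complex Hilbert space with inner product $(\cdot,\cdot)$ linear in the first argument, and let $\mathbb R_+=[0,\infty)$. A linear relation in $\mathfrak M$ is a linear subspace $T$ of $\mathfrak M\times\mathfrak M$; operators are identified with their graphs, and $T^{-1}=\{\{f',f\}:\{f,f'\}\in T\}$, $cT=\{\{f,cf'\}:\{f,f'\}\in T\}$, $T+c=\{\{f,f'+cf\}:\{f,f'\}\in T\}$, $T^*=\{\{k,k'\}:(h',k)=(h,k')\text{ for all }\{h,h'\}\in T\}$. The relation $T$ is dissipative (accumulative) if $\operatorname{Im}(f',f)\ge 0$ ($\le 0$) for all $\{f,f'\}\in T$, maximal dissipative (maximal accumulative) if it has no proper extension with this property, and $T\ge 0$ ($T\le 0$) if $(f',f)$ is real and $\ge 0$ ($\le 0$) for all $\{f,f'\}\in T$. A Nevanlinna family is a family of linear relations $\mathcal M(\lambda)$, $\lambda\in\mathbb C\setminus\mathbb R$, in $\mathfrak M$ such that $\mathcal M(\lambda)$ is maximal dissipative for $\lambda\in\mathbb C_+$ and maximal accumulative for $\lambda\in\mathbb C_-$; $\mathcal M(\lambda)^*=\mathcal M(\bar\lambda)$;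 and, for some $\mu\in\mathbb C_+$ (respectively $\mathbb C_-$), $(\mathcal M(\lambda)+\mu)^{-1}$ is an everywhere defined bounded operator depending holomorphically on $\lambda\in\mathbb C_+$ (respectively $\mathbb C_-$). A family of linear relations $\mathcal M(\lambda)$, $\lambda\in\mathbb C\setminus\mathbb R_+$, is a Stieltjes family (an inverse Stieltjes family) if its restriction to $\mathbb C\setminus\mathbb R$ is a Nevanlinna family, $\mathcal M(x)\ge 0$ ($\mathcal M(x)\le 0$) for all $x<0$, and, for some $\mu\in\mathbb C_+$ (respectively $\mathbb C_-$), the function $(\mathcal M(\lambda)+\mu)^{-1}$, $\lambda\in\mathbb C_+$ (respectively $\mathbb C_-$), has an analytic continuation to $(-\infty,0)$ whose value at $x<0$ is the everywhere defined bounded operator $(\mathcal M(x)+\mu)^{-1}$. Consider the transformations $\Phi_+(\mathcal Q)(\lambda)=-\lambda^{-1}\mathcal Q(\lambda)^{-1}$ and $\Phi_-(\mathcal R)(\lambda)=-\lambda\,\mathcal R(\lambda)^{-1}$ of families of linear relations on $\mathbb C\setminus\mathbb R_+$, and let $\sqrt\lambda$, $\lambda\in\mathbb C\setminus\mathbb R_+$,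 be the branch of the square root with $\operatorname{Im}\sqrt\lambda>0$. Then: 1. There is exactly one Stieltjes family $\mathcal Q$ in $\mathfrak M$ with $\Phi_+(\mathcal Q)=\mathcal Q$, namely $\mathcal Q_0(\lambda)=\dfrac{i}{\sqrt\lambda}\,I_{\mathfrak M}$, and $\mathcal Q_0(-1)=I_{\mathfrak M}$. 2. There is exactly one inverse Stieltjes family $\mathcal R$ in $\mathfrak M$ with $\Phi_-(\mathcal R)=\mathcal R$, namely $\mathcal R_0(\lambda)=i\sqrt\lambda\,I_{\mathfrak M}$, and $\mathcal R_0(-1)=-I_{\mathfrak M}$. -/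

import Mathlib

namespace StieltjesFamilies

/-- Linear relations in `M`: linear subspaces of `M × M`, whose elements `(f, f')` are written
`{f, f'}` in the literature. An operator is identified with its graph. -/
abbrev LinRel (M : Type*) [NormedAddCommGroup M] [InnerProductSpace ℂ M] : Type _ :=
  Submodule ℂ (M × M)

namespace LinRel

variable {M : Type*} [NormedAddCommGroup M] [InnerProductSpace ℂ M]

/-- `T⁻¹ = {(f', f) : (f, f') ∈ T}`. -/
def inv (T : LinRel M) : LinRel M where
  carrier := {p | (p.2, p.1) ∈ T}
  add_mem' ha hb := T.add_mem ha hb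
  zero_mem' := T.zero_mem
  smul_mem' c _ hx := T.smul_mem c hx

/-- `c T = {(f, c f') : (f, f') ∈ T}`. -/
def scale (c : ℂ) (T : LinRel M) : LinRel M :=
  T.map (LinearMap.prodMap LinearMap.id (c • LinearMap.id))

/-- `T + c I = {(f, f' + c f) : (f, f') ∈ T}`. -/
def shift (T : LinRel M) (c : ℂ) : LinRel M :=
  T.map (LinearMap.prod (LinearMap.fst ℂ M M) (LinearMap.snd ℂ M M + c • LinearMap.fst ℂ M M))

/-- The graph of the everywhere defined bounded operator `A`. -/
def ofBounded (A : M →L[ℂ] M) : LinRel M := LinearMap.graph (A : M →ₗ[ℂ] M)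

/-- `Im (f', f) ≥ 0` on `T`. Mathlib's inner product is linear in the second argument, so
`(f', f)` is `inner ℂ f f'`. -/
def IsDissipative (T : LinRel M) : Prop := ∀ p ∈ T, 0 ≤ (inner ℂ p.1 p.2).im

/-- `Im (f', f) ≤ 0` on `T`. -/
def IsAccumulative (T : LinRel M) : Prop := ∀ p ∈ T, (inner ℂ p.1 p.2).im ≤ 0

/-- `(f', f)` is real and nonnegative on `T`. -/
def IsNonneg (T : LinRel M) : Prop :=
  ∀ p ∈ T, (inner ℂ p.1 p.2).im = 0 ∧ 0 ≤ (inner ℂ p.1 p.2).re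

/-- `(f', f)` is real and nonpositive on `T`. -/
def IsNonpos (T : LinRel M) : Prop :=
  ∀ p ∈ T, (inner ℂ p.1 p.2).im = 0 ∧ (inner ℂ p.1 p.2).re ≤ 0

end LinRel

/-- The domain `ℂ \ ℝ`. -/
def nonrealPlane : Set ℂ := {z | z.im ≠ 0}

/-- The domain `ℂ \ ℝ₊`, where `ℝ₊ = [0, ∞)`. -/
def cutPlane : Set ℂ := {z | z.im ≠ 0 ∨ z.re < 0}

theorem nonrealPlane_subset_cutPlane : nonrealPlane ⊆ cutPlane := fun _ h => Or.inl h

theorem conj_mem_nonrealPlane {z : ℂ} (hz : z ∈ nonrealPlane) :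
    (starRingEnd ℂ) z ∈ nonrealPlane := by
  simpa [nonrealPlane] using hz

theorem neg_one_mem_cutPlane : (-1 : ℂ) ∈ cutPlane := by
  simp [cutPlane]

section Families

variable {M : Type*} [NormedAddCommGroup M] [InnerProductSpace ℂ M]

/-- `(T(z) + μ)⁻¹` is an everywhere defined bounded operator for all `z ∈ S` in the domain of
the family `T`, and `z ↦ (T(z) + μ)⁻¹`, `z ∈ S`, is the restriction of an operator function that
is holomorphic on an open neighbourhood of `S`. For open `S` this says that it is holomorphic
on `S`. -/
def HasHolomorphicResolventOn {D : Set ℂ} (T : D → LinRel M) (μ : ℂ) (S : Set ℂ) : Prop :=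
  ∃ (U : Set ℂ) (F : ℂ → M →L[ℂ] M), IsOpen U ∧ S ⊆ U ∧ DifferentiableOn ℂ F U ∧
    ∀ z : D, (z : ℂ) ∈ S → ((T z).shift μ).inv = LinRel.ofBounded (F z)

/-- Nevanlinna families of linear relations in `M`. -/
structure IsNevanlinnaFamily (T : nonrealPlane → LinRel M) : Prop where
  maximal_dissipative : ∀ z : nonrealPlane, 0 < (z : ℂ).im → Maximal LinRel.IsDissipative (T z)
  maximal_accumulative : ∀ z : nonrealPlane, (z : ℂ).im < 0 → Maximal LinRel.IsAccumulative (T z)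
  adjoint_eq : ∀ z : nonrealPlane,
    (T z).adjoint = T ⟨(starRingEnd ℂ) (z : ℂ), conj_mem_nonrealPlane z.2⟩
  holomorphic_upper : ∃ μ : ℂ, 0 < μ.im ∧ HasHolomorphicResolventOn T μ {z | 0 < z.im}
  holomorphic_lower : ∃ μ : ℂ, μ.im < 0 ∧ HasHolomorphicResolventOn T μ {z | z.im < 0}

/-- The restriction to `ℂ \ ℝ` of a family on `ℂ \ ℝ₊`. -/
def restrictNonreal (T : cutPlane → LinRel M) : nonrealPlane → LinRel M :=
  fun z => T ⟨z, nonrealPlane_subset_cutPlane z.2⟩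

/-- For some `μ ∈ ℂ₊` (respectively `ℂ₋`) the function `(T(z) + μ)⁻¹`, `z ∈ ℂ₊`
(respectively `ℂ₋`), continues analytically to `(-∞, 0)`, with the value `(T(x) + μ)⁻¹`
at `x < 0`. -/
def ContinuesToNegativeAxis (T : cutPlane → LinRel M) : Prop :=
  (∃ μ : ℂ, 0 < μ.im ∧ HasHolomorphicResolventOn T μ {z | z ∈ cutPlane ∧ 0 ≤ z.im}) ∧
  (∃ μ : ℂ, μ.im < 0 ∧ HasHolomorphicResolventOn T μ {z | z ∈ cutPlane ∧ z.im ≤ 0})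

/-- Stieltjes families of linear relations in `M`. -/
structure IsStieltjesFamily (T : cutPlane → LinRel M) : Prop where
  nevanlinna : IsNevanlinnaFamily (restrictNonreal T)
  nonneg : ∀ z : cutPlane, (z : ℂ).im = 0 → (T z).IsNonneg
  continuation : ContinuesToNegativeAxis T

/-- Inverse Stieltjes families of linear relations in `M`. -/
structure IsInverseStieltjesFamily (T : cutPlane → LinRel M) : Prop where
  nevanlinna : IsNevanlinnaFamily (restrictNonreal T)
  nonpos : ∀ z : cutPlane, (z : ℂ).im = 0 → (T z).IsNonpos
  continuation : ContinuesToNegativeAxis T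

/-- The transformation `Q(z) ↦ -Q(z)⁻¹ / z`. -/
noncomputable def phiPlus (Q : cutPlane → LinRel M) : cutPlane → LinRel M :=
  fun z => ((Q z).inv).scale (-(z : ℂ)⁻¹)

/-- The transformation `R(z) ↦ -z R(z)⁻¹`. -/
noncomputable def phiMinus (R : cutPlane → LinRel M) : cutPlane → LinRel M :=
  fun z => ((R z).inv).scale (-(z : ℂ))

end Families

/-- The branch of the square root on `ℂ \ ℝ₊` with positive imaginary part. -/
noncomputable def cutSqrt (z : ℂ) : ℂ := Complex.I * (-z) ^ (1 / 2 : ℂ)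

theorem cutSqrt_sq (z : ℂ) : cutSqrt z ^ 2 = z := by
  have h : ((-z) ^ (1 / 2 : ℂ)) ^ 2 = -z := by
    rw [← Complex.cpow_nat_mul]; norm_num
  rw [cutSqrt, mul_pow, h, Complex.I_sq]; ring

theorem cutSqrt_im_pos {z : ℂ} (hz : z ∈ cutPlane) : 0 < (cutSqrt z).im := by
  have hs : -z ∈ Complex.slitPlane := by
    rcases hz with h | h
    · exact Or.inr (by simpa using h)
    · exact Or.inl (by simpa using h)
  have h0 : -z ≠ 0 := Complex.slitPlane_ne_zero hs
  have harg : (-z).arg ≠ Real.pi := (Complex.mem_slitPlane_iff_arg.mp hs).1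
  have h1 := Complex.neg_pi_lt_arg (-z)
  have h2 := lt_of_le_of_ne (Complex.arg_le_pi (-z)) harg
  rw [cutSqrt, Complex.I_mul_im, Complex.cpow_def_of_ne_zero h0, Complex.exp_re]
  refine mul_pos (Real.exp_pos _) (Real.cos_pos_of_mem_Ioo ?_)
  have him : (Complex.log (-z) * (1 / 2 : ℂ)).im = (-z).arg / 2 := by
    rw [show (1 / 2 : ℂ) = ((1 / 2 : ℝ) : ℂ) by norm_num, Complex.im_mul_ofReal, Complex.log_im]
    ring
  rw [him]
  constructor <;> linarith

/-- `Q₀(z) = (i / √z) I`. -/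
noncomputable def Q0 (M : Type*) [NormedAddCommGroup M] [InnerProductSpace ℂ M] :
    cutPlane → LinRel M :=
  fun z => LinRel.ofBounded ((Complex.I / cutSqrt z) • ContinuousLinearMap.id ℂ M)

/-- `R₀(z) = i √z I`. -/
noncomputable def R0 (M : Type*) [NormedAddCommGroup M] [InnerProductSpace ℂ M] :
    cutPlane → LinRel M :=
  fun z => LinRel.ofBounded ((Complex.I * cutSqrt z) • ContinuousLinearMap.id ℂ M)

end StieltjesFamilies

namespace StieltjesFamilies

namespace LinRel

variable {M : Type*} [NormedAddCommGroup M] [InnerProductSpace ℂ M]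

/-! A fixed point is determined on the negative axis by algebra and sign, and elsewhere by analytic
continuation. Both transformations have the form `T ↦ d T⁻¹` with `d = a²`, where `a` is `i/√z` or
`i√z`. If `T` is fixed and `(f, f') ∈ T`, then `(f', a² f) ∈ T`; subtracting `a (f, f')` puts `(g,
-a g)` in `T`, where `g = f' - a f`. At `x < 0` the scalar `a` is real, positive in the Stieltjes
case and negative in the inverse one, so the sign of `T(x)` forces `g = 0`: `T(x) ⊆ a I`
(`le_ofBounded_of_isNonneg`, `le_ofBounded_of_isNonpos`).

The resolvent `F = (T + μ)⁻¹` is everywhere defined, hence `(a(x) + μ) F(x) = I` for `x < 0`. The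
left side is holomorphic, so the identity theorem carries this equation over each half-plane joined
with the negative axis, and there it recovers `T = a I`
(`eq_ofBounded_of_hasHolomorphicResolventOn`). Conversely, `a I` is a family of the required kind
because `a` is holomorphic, commutes with conjugation, has nonnegative imaginary part on the upper
half-plane and has the right sign on the negative axis. -/

theorem mem_inv {T : LinRel M} {p : M × M} : p ∈ T.inv ↔ (p.2, p.1) ∈ T := Iff.rfl

theorem mem_shift {T : LinRel M} {c : ℂ} {p : M × M} :
    p ∈ T.shift c ↔ (p.1, p.2 - c • p.1) ∈ T := by
  constructor
  · rintro ⟨q, hq, rfl⟩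
    simpa using hq
  · intro h
    exact ⟨_, h, by ext <;> simp⟩

theorem mem_inv_shift {T : LinRel M} {c : ℂ} {p : M × M} :
    p ∈ (T.shift c).inv ↔ (p.2, p.1 - c • p.2) ∈ T := by
  rw [mem_inv, mem_shift]

theorem mk_mem_scale_inv {T : LinRel M} (c : ℂ) {f f' : M} (h : (f, f') ∈ T) :
    (f', c • f) ∈ (T.inv).scale c :=
  ⟨(f', f), h, by simp⟩

theorem mem_ofBounded {A : M →L[ℂ] M} {p : M × M} : p ∈ ofBounded A ↔ p.2 = A p.1 :=
  LinearMap.mem_graph_iff _ _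

/-! ### Scalar operators as linear relations, and relations contained in them -/

theorem mem_ofBounded_smul_id {c : ℂ} {p : M × M} :
    p ∈ ofBounded (c • ContinuousLinearMap.id ℂ M) ↔ p.2 = c • p.1 := by
  simp [mem_ofBounded]

theorem inner_of_mem_ofBounded_smul_id {c : ℂ} {p : M × M}
    (hp : p ∈ ofBounded (c • ContinuousLinearMap.id ℂ M)) :
    inner ℂ p.1 p.2 = c * ((‖p.1‖ ^ 2 : ℝ) : ℂ) := by
  rw [mem_ofBounded_smul_id.mp hp, inner_smul_right, inner_self_eq_norm_sq_to_K]
  norm_cast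

theorem inner_im_of_mem_ofBounded_smul_id {c : ℂ} {p : M × M}
    (hp : p ∈ ofBounded (c • ContinuousLinearMap.id ℂ M)) :
    (inner ℂ p.1 p.2).im = c.im * ‖p.1‖ ^ 2 := by
  rw [inner_of_mem_ofBounded_smul_id hp, Complex.im_mul_ofReal]

theorem inner_re_of_mem_ofBounded_smul_id {c : ℂ} {p : M × M}
    (hp : p ∈ ofBounded (c • ContinuousLinearMap.id ℂ M)) :
    (inner ℂ p.1 p.2).re = c.re * ‖p.1‖ ^ 2 := by
  rw [inner_of_mem_ofBounded_smul_id hp, Complex.re_mul_ofReal]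

/-- If an extension of `c I` contains `(f, f')`, then with `h = f' - c f` it contains
`(h, d h)` for every `d`. -/
theorem smul_mem_of_le {T : LinRel M} {c : ℂ}
    (hT : ofBounded (c • ContinuousLinearMap.id ℂ M) ≤ T) {p : M × M} (hp : p ∈ T) (d : ℂ) :
    (p.2 - c • p.1, d • (p.2 - c • p.1)) ∈ T := by
  -- Subtracting `(f, c f)` from `(f, f')` leaves `h` in the multivalued part of `T`, so any
  -- multiple of `(0, h)` can be added to `(h, c h)`.
  have h0 : ((0 : M), p.2 - c • p.1) ∈ T := by
    have := T.sub_mem hp (hT ((mem_ofBounded_smul_id (p := (p.1, c • p.1))).mpr rfl))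
    simpa [Prod.sub_def] using this
  have h1 := T.add_mem (hT ((mem_ofBounded_smul_id
    (p := (p.2 - c • p.1, c • (p.2 - c • p.1)))).mpr rfl)) (T.smul_mem (d - c) h0)
  convert h1 using 1
  ext
  · simp
  · simp only [Prod.snd_add, Prod.smul_snd]
    module

/-- A dissipative extension containing `(f, f')` contains `(h, -i h)` for `h = f' - c f`; there the
imaginary part is `-‖h‖²`, so `h = 0`. The accumulative case uses `(h, i h)`. -/
theorem maximal_isDissipative_ofBounded {c : ℂ} (hc : 0 ≤ c.im) :
    Maximal IsDissipative (ofBounded (c • ContinuousLinearMap.id ℂ M)) := by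
  refine ⟨fun p hp => ?_, fun T hT hle p hp => ?_⟩
  · rw [inner_im_of_mem_ofBounded_smul_id hp]
    positivity
  · have h := hT _ (smul_mem_of_le hle hp (-Complex.I))
    rw [inner_im_of_mem_ofBounded_smul_id (c := -Complex.I) (mem_ofBounded_smul_id.mpr rfl)] at h
    simp only [Complex.neg_im, Complex.I_im] at h
    rw [mem_ofBounded_smul_id, ← sub_eq_zero, ← norm_eq_zero]
    nlinarith [norm_nonneg (p.2 - c • p.1)]

theorem maximal_isAccumulative_ofBounded {c : ℂ} (hc : c.im ≤ 0) :
    Maximal IsAccumulative (ofBounded (c • ContinuousLinearMap.id ℂ M)) := by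
  refine ⟨fun p hp => ?_, fun T hT hle p hp => ?_⟩
  · rw [inner_im_of_mem_ofBounded_smul_id hp]
    exact mul_nonpos_of_nonpos_of_nonneg hc (by positivity)
  · have h := hT _ (smul_mem_of_le hle hp Complex.I)
    rw [inner_im_of_mem_ofBounded_smul_id (c := Complex.I) (mem_ofBounded_smul_id.mpr rfl)] at h
    simp only [Complex.I_im] at h
    rw [mem_ofBounded_smul_id, ← sub_eq_zero, ← norm_eq_zero]
    nlinarith [norm_nonneg (p.2 - c • p.1)]

theorem adjoint_ofBounded_smul_id (c : ℂ) :
    (ofBounded (c • ContinuousLinearMap.id ℂ M)).adjoint =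
      ofBounded ((starRingEnd ℂ) c • ContinuousLinearMap.id ℂ M) := by
  ext ⟨k, k'⟩
  rw [Submodule.mem_adjoint_iff, mem_ofBounded_smul_id]
  constructor
  · intro h
    refine (ext_inner_left ℂ fun a => ?_)
    have := h a (c • a) (mem_ofBounded_smul_id.mpr rfl)
    rw [inner_smul_left] at this
    rw [inner_smul_right]
    exact (sub_eq_zero.mp this).symm
  · intro h a b hab
    rw [mem_ofBounded_smul_id] at hab
    simp only at h hab
    rw [h, hab, inner_smul_left, inner_smul_right, sub_self]

theorem inv_shift_ofBounded_smul_id {c μ : ℂ} (h : c + μ ≠ 0) :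
    ((ofBounded (c • ContinuousLinearMap.id ℂ M)).shift μ).inv =
      ofBounded ((c + μ)⁻¹ • ContinuousLinearMap.id ℂ M) := by
  ext p
  rw [mem_inv_shift, mem_ofBounded_smul_id, mem_ofBounded_smul_id, eq_inv_smul_iff₀ h, add_smul,
    sub_eq_iff_eq_add, eq_comm]

theorem scale_inv_ofBounded_smul_id {c d : ℂ} (hc : c ≠ 0) (hd : d = c ^ 2) :
    ((ofBounded (c • ContinuousLinearMap.id ℂ M)).inv).scale d =
      ofBounded (c • ContinuousLinearMap.id ℂ M) := by
  subst hd
  ext p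
  rw [mem_ofBounded_smul_id]
  constructor
  · rintro ⟨q, hq, rfl⟩
    have hq' := mem_ofBounded_smul_id.mp (mem_inv.mp hq)
    simp only at hq'
    simp [hq', smul_smul, pow_two]
  · intro h
    refine ⟨(p.1, c⁻¹ • p.1), mem_inv.mpr (mem_ofBounded_smul_id.mpr ?_), ?_⟩
    · simp [smul_smul, hc]
    · ext
      · simp
      · simp [h, smul_smul, pow_two, hc]

/-- A relation all of whose elements `(f, f')` are swapped to `(f', a² f)` contains
`(g, -a g)` for `g = f' - a f`. -/
theorem mk_sub_mem {T : LinRel M} {a d : ℂ} (hd : d = a ^ 2) (hT : (T.inv).scale d = T)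
    {p : M × M} (hp : p ∈ T) : (p.2 - a • p.1, (-a) • (p.2 - a • p.1)) ∈ T := by
  subst hd
  have h1 : (p.2, a ^ 2 • p.1) ∈ T := by
    have := mk_mem_scale_inv (a ^ 2) hp
    rwa [hT] at this
  convert T.sub_mem h1 (T.smul_mem a hp) using 1
  ext
  · simp
  · simp only [Prod.snd_sub, Prod.smul_snd]
    module

theorem le_ofBounded_of_isNonneg {T : LinRel M} {a d : ℂ} (hd : d = a ^ 2)
    (hT : (T.inv).scale d = T) (hpos : T.IsNonneg) (ha : 0 < a.re) :
    T ≤ ofBounded (a • ContinuousLinearMap.id ℂ M) := by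
  intro p hp
  have h := (hpos _ (mk_sub_mem hd hT hp)).2
  rw [inner_re_of_mem_ofBounded_smul_id (c := -a) (mem_ofBounded_smul_id.mpr rfl)] at h
  simp only [Complex.neg_re] at h
  rw [mem_ofBounded_smul_id, ← sub_eq_zero, ← norm_eq_zero]
  by_contra hne
  have : 0 < a.re * ‖p.2 - a • p.1‖ ^ 2 := by positivity
  linarith

theorem le_ofBounded_of_isNonpos {T : LinRel M} {a d : ℂ} (hd : d = a ^ 2)
    (hT : (T.inv).scale d = T) (hneg : T.IsNonpos) (ha : a.re < 0) :
    T ≤ ofBounded (a • ContinuousLinearMap.id ℂ M) := by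
  intro p hp
  have h := (hneg _ (mk_sub_mem hd hT hp)).2
  rw [inner_re_of_mem_ofBounded_smul_id (c := -a) (mem_ofBounded_smul_id.mpr rfl)] at h
  simp only [Complex.neg_re] at h
  rw [mem_ofBounded_smul_id, ← sub_eq_zero, ← norm_eq_zero]
  by_contra hne
  have : 0 < -a.re * ‖p.2 - a • p.1‖ ^ 2 :=
    mul_pos (neg_pos.mpr ha) (by positivity)
  linarith

/-- If `(T + μ)⁻¹` is the bounded operator `F` and `T ⊆ c I`, then `(c + μ) F = I`. -/
theorem smul_resolvent_eq_id {T : LinRel M} {c μ : ℂ} {F : M →L[ℂ] M}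
    (hF : (T.shift μ).inv = ofBounded F)
    (hT : T ≤ ofBounded (c • ContinuousLinearMap.id ℂ M)) :
    (c + μ) • F = ContinuousLinearMap.id ℂ M := by
  ext g
  have h : (g, F g) ∈ (T.shift μ).inv := by
    rw [hF, mem_ofBounded]
  have := mem_ofBounded_smul_id.mp (hT (mem_inv_shift.mp h))
  simp only at this
  simp [add_smul, ← this]

/-- The resolvent determines the relation, since `(f, f') ∈ T` exactly when `f = F (f' + μ f)`.
Multiplying by `c + μ`, rather than inverting it, avoids a separate case `c + μ = 0`. -/
theorem eq_ofBounded_of_smul_resolvent_eq_id {T : LinRel M} {c μ : ℂ} {F : M →L[ℂ] M}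
    (hF : (T.shift μ).inv = ofBounded F) (hc : (c + μ) • F = ContinuousLinearMap.id ℂ M) :
    T = ofBounded (c • ContinuousLinearMap.id ℂ M) := by
  have hc' (g : M) : (c + μ) • F g = g := by
    simpa using congrArg (fun A : M →L[ℂ] M => A g) hc
  ext ⟨f, f'⟩
  have h : (f, f') ∈ T ↔ f = F (f' + μ • f) := by
    rw [← mem_ofBounded (p := (f' + μ • f, f)), ← hF, mem_inv_shift]
    simp
  rw [h, mem_ofBounded_smul_id]
  constructor
  · intro hf
    have := hc' (f' + μ • f)
    rw [← hf, add_smul] at this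
    exact (add_right_cancel this).symm
  · intro hf
    simp only at hf
    rw [hf, ← add_smul, map_smul, hc']

end LinRel

/-! ### The cut plane and the square root on it -/

theorem isOpen_cutPlane : IsOpen cutPlane :=
  (isOpen_ne_fun Complex.continuous_im continuous_const).union
    (isOpen_lt Complex.continuous_re continuous_const)

theorem conj_mem_cutPlane {z : ℂ} (hz : z ∈ cutPlane) : (starRingEnd ℂ) z ∈ cutPlane := by
  simpa [cutPlane] using hz

theorem neg_mem_slitPlane {z : ℂ} (hz : z ∈ cutPlane) : -z ∈ Complex.slitPlane := by
  rcases hz with h | h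
  · exact Or.inr (by simpa using h)
  · exact Or.inl (by simpa using h)

theorem isPreconnected_cutPlane_upper : IsPreconnected {z | z ∈ cutPlane ∧ 0 ≤ z.im} := by
  refine Convex.isPreconnected ?_
  rintro x ⟨hx, hx'⟩ y ⟨hy, hy'⟩ a b ha hb hab
  simp only [cutPlane, Set.mem_ofPred_eq, Complex.add_im, Complex.add_re, Complex.real_smul,
    Complex.re_ofReal_mul, Complex.im_ofReal_mul] at *
  refine ⟨?_, by positivity⟩
  -- A convex combination can be real only if every point of nonzero weight is real, hence on the
  -- negative axis.
  by_cases h : a * x.im + b * y.im = 0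
  · right
    have h1 := mul_nonneg ha hx'
    have h2 := mul_nonneg hb hy'
    have e1 : a * x.im = 0 := by linarith
    have e2 : b * y.im = 0 := by linarith
    have k1 : a ≠ 0 → x.re < 0 := fun h => hx.resolve_left (by simpa [h] using e1)
    have k2 : b ≠ 0 → y.re < 0 := fun h => hy.resolve_left (by simpa [h] using e2)
    rcases ha.eq_or_lt with rfl | ha'
    · have : b = 1 := by linarith
      subst this
      simpa using k2 one_ne_zero
    · have l1 := mul_neg_of_pos_of_neg ha' (k1 ha'.ne')
      rcases hb.eq_or_lt with rfl | hb'
      · simpa using l1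
      · linarith [mul_neg_of_pos_of_neg hb' (k2 hb'.ne')]
  · exact Or.inl h

theorem isPreconnected_cutPlane_lower : IsPreconnected {z | z ∈ cutPlane ∧ z.im ≤ 0} := by
  have h := isPreconnected_cutPlane_upper.image (starRingEnd ℂ) Complex.continuous_conj.continuousOn
  convert h using 1
  ext z
  constructor
  · rintro ⟨hz, hz'⟩
    exact ⟨(starRingEnd ℂ) z, ⟨conj_mem_cutPlane hz, by simpa using hz'⟩, by simp⟩
  · rintro ⟨w, ⟨hw, hw'⟩, rfl⟩
    exact ⟨conj_mem_cutPlane hw, by simpa using hw'⟩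

theorem cutSqrt_ne_zero {z : ℂ} (hz : z ∈ cutPlane) : cutSqrt z ≠ 0 := fun h => by
  simpa [h] using cutSqrt_im_pos hz

theorem differentiableOn_cutSqrt : DifferentiableOn ℂ cutSqrt cutPlane := fun _ hz =>
  ((differentiableAt_id.neg.cpow_const (neg_mem_slitPlane hz)).const_mul
    Complex.I).differentiableWithinAt

theorem cutSqrt_conj {z : ℂ} (hz : z ∈ cutPlane) :
    cutSqrt ((starRingEnd ℂ) z) = -(starRingEnd ℂ) (cutSqrt z) := by
  have h : cutSqrt ((starRingEnd ℂ) z) ^ 2 = ((starRingEnd ℂ) (cutSqrt z)) ^ 2 := by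
    rw [cutSqrt_sq, ← map_pow, cutSqrt_sq]
  refine (sq_eq_sq_iff_eq_or_eq_neg.mp h).resolve_left fun h' => ?_
  have h1 := cutSqrt_im_pos (conj_mem_cutPlane hz)
  have h2 := cutSqrt_im_pos hz
  rw [h', Complex.conj_im] at h1
  linarith

/-- As `Im √z > 0`, this shows that `Re √z` has the sign of `Im z`; in particular `√z` is purely
imaginary on the negative axis. -/
theorem im_eq_two_mul_cutSqrt (z : ℂ) : z.im = 2 * (cutSqrt z).im * (cutSqrt z).re := by
  conv_lhs => rw [← cutSqrt_sq z, pow_two, Complex.mul_im]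
  ring

theorem cutSqrt_re_nonneg {z : ℂ} (hz : z ∈ cutPlane) (h : 0 ≤ z.im) : 0 ≤ (cutSqrt z).re := by
  rw [im_eq_two_mul_cutSqrt] at h
  exact nonneg_of_mul_nonneg_right h (by linarith [cutSqrt_im_pos hz])

theorem cutSqrt_eq_of_im_eq_zero {z : ℂ} (hz : z ∈ cutPlane) (h : z.im = 0) :
    cutSqrt z = ((cutSqrt z).im : ℂ) * Complex.I := by
  have h0 : (cutSqrt z).re = 0 := by
    rw [im_eq_two_mul_cutSqrt] at h
    exact (mul_eq_zero.mp h).resolve_left (by linarith [cutSqrt_im_pos hz] |> ne_of_gt)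
  apply Complex.ext <;> simp [h0]

/-! ### Analytic continuation from the negative axis; families `c(z) I` -/

section ScalarFamilies

variable {M : Type*} [NormedAddCommGroup M] [InnerProductSpace ℂ M]

/-- A family whose resolvent is holomorphic on `S` and which is contained in the holomorphic
scalar family `c I` on the negative axis equals `c I` on `S`. -/
theorem eq_ofBounded_of_hasHolomorphicResolventOn [CompleteSpace M] {T : cutPlane → LinRel M} {c : ℂ → ℂ}
    (hc : DifferentiableOn ℂ c cutPlane)
    (hT : ∀ z : cutPlane, (z : ℂ).im = 0 →
      T z ≤ LinRel.ofBounded (c z • ContinuousLinearMap.id ℂ M))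
    {μ : ℂ} {S : Set ℂ} (hS : IsPreconnected S) (hSD : S ⊆ cutPlane)
    (hneg : ∀ x : ℝ, x < 0 → (x : ℂ) ∈ S) (h : HasHolomorphicResolventOn T μ S)
    (z : cutPlane) (hz : (z : ℂ) ∈ S) :
    T z = LinRel.ofBounded (c z • ContinuousLinearMap.id ℂ M) := by
  obtain ⟨U, F, hU, hSU, hF, hTF⟩ := h
  have hreal (x : ℝ) (hx : x < 0) : (c x + μ) • F x = ContinuousLinearMap.id ℂ M :=
    LinRel.smul_resolvent_eq_id (hTF ⟨x, hSD (hneg x hx)⟩ (hneg x hx)) (hT ⟨x, _⟩ (by simp))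
  have hdiff : DifferentiableOn ℂ (fun w => (c w + μ) • F w) (U ∩ cutPlane) :=
    ((hc.mono Set.inter_subset_right).add_const μ).smul (hF.mono Set.inter_subset_left)
  -- Holomorphy on an open neighbourhood of `S` lets the identity theorem start at `-1`, although
  -- this is a boundary point of the half-plane.
  have han : AnalyticOnNhd ℂ (fun w => (c w + μ) • F w) S := fun w hw =>
    hdiff.analyticAt ((hU.inter isOpen_cutPlane).mem_nhds ⟨hSU hw, hSD hw⟩)
  have hfreq : ∃ᶠ w in nhdsWithin (-1 : ℂ) {-1}ᶜ,
      (c w + μ) • F w = ContinuousLinearMap.id ℂ M := by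
    have ht : Filter.Tendsto (fun x : ℝ => (x : ℂ)) (nhdsWithin (-1) {-1}ᶜ)
        (nhdsWithin (-1) {-1}ᶜ) := by
      refine tendsto_nhdsWithin_iff.mpr ⟨?_, ?_⟩
      · have := (Complex.continuous_ofReal.tendsto (-1)).mono_left
          (nhdsWithin_le_nhds (s := {-1}ᶜ))
        simpa using this
      · filter_upwards [self_mem_nhdsWithin] with x hx
        intro h
        exact hx (Complex.ofReal_injective (by simpa using h))
    refine ht.frequently (Filter.Eventually.frequently ?_)
    filter_upwards [nhdsWithin_le_nhds (Iio_mem_nhds (by norm_num : (-1 : ℝ) < 0))] with x hx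
    exact hreal x hx
  have heq := han.eqOn_of_preconnected_of_frequently_eq
    (analyticOnNhd_const (v := ContinuousLinearMap.id ℂ M)) hS
    (by simpa using hneg (-1) (by norm_num)) hfreq hz
  exact LinRel.eq_ofBounded_of_smul_resolvent_eq_id (hTF z hz) heq

theorem eq_ofBounded_of_continuesToNegativeAxis [CompleteSpace M] {T : cutPlane → LinRel M} {c : ℂ → ℂ}
    (hc : DifferentiableOn ℂ c cutPlane)
    (hT : ∀ z : cutPlane, (z : ℂ).im = 0 →
      T z ≤ LinRel.ofBounded (c z • ContinuousLinearMap.id ℂ M))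
    (h : ContinuesToNegativeAxis T) (z : cutPlane) :
    T z = LinRel.ofBounded (c z • ContinuousLinearMap.id ℂ M) := by
  obtain ⟨⟨μ, -, hμ⟩, ν, -, hν⟩ := h
  -- Each closed half carries its own `μ`; both halves contain the negative axis, where the
  -- continuation starts.
  rcases le_total 0 (z : ℂ).im with hz | hz
  · exact eq_ofBounded_of_hasHolomorphicResolventOn hc hT isPreconnected_cutPlane_upper
      (fun _ h => h.1) (fun x hx => ⟨Or.inr (by simpa using hx), by simp⟩) hμ z ⟨z.2, hz⟩
  · exact eq_ofBounded_of_hasHolomorphicResolventOn hc hT isPreconnected_cutPlane_lower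
      (fun _ h => h.1) (fun x hx => ⟨Or.inr (by simpa using hx), by simp⟩) hν z ⟨z.2, hz⟩

theorem hasHolomorphicResolventOn_scalar {D : Set ℂ} {c : ℂ → ℂ}
    (hc : DifferentiableOn ℂ c cutPlane) {μ : ℂ} {S : Set ℂ} (hSD : S ⊆ cutPlane)
    (hμ : ∀ z ∈ S, c z + μ ≠ 0) :
    HasHolomorphicResolventOn
      (fun z : D => LinRel.ofBounded (c z • ContinuousLinearMap.id ℂ M)) μ S := by
  -- The zeros of `c + μ` are removed to leave an open neighbourhood of `S` on which the scalar
  -- resolvent is holomorphic.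
  refine ⟨cutPlane ∩ (fun z => c z + μ) ⁻¹' {0}ᶜ,
    fun z => (c z + μ)⁻¹ • ContinuousLinearMap.id ℂ M, ?_, fun z hz => ⟨hSD hz, hμ z hz⟩, ?_,
    fun z hz => LinRel.inv_shift_ofBounded_smul_id (hμ z hz)⟩
  · exact (hc.add_const μ).continuousOn.isOpen_inter_preimage isOpen_cutPlane
      isOpen_compl_singleton
  · exact (((hc.mono Set.inter_subset_left).add_const μ).inv fun z hz => hz.2).smul_const _

variable {c : ℂ → ℂ}

theorem im_nonpos_of_conj (hconj : ∀ z ∈ cutPlane, c ((starRingEnd ℂ) z) = (starRingEnd ℂ) (c z))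
    (him : ∀ z ∈ cutPlane, 0 ≤ z.im → 0 ≤ (c z).im) {z : ℂ} (hz : z ∈ cutPlane) (h : z.im ≤ 0) :
    (c z).im ≤ 0 := by
  have := him _ (conj_mem_cutPlane hz) (by simpa using h)
  rw [hconj z hz, Complex.conj_im] at this
  linarith

/-- This makes `μ = i` admissible for the upper resolvent of a scalar family; its counterpart `μ =
-i` serves the lower one. -/
theorem add_I_ne_zero_of_im_nonneg {w : ℂ} (h : 0 ≤ w.im) : w + Complex.I ≠ 0 := fun h0 => by
  have := congrArg Complex.im h0
  simp only [Complex.add_im, Complex.I_im, Complex.zero_im] at this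
  linarith

theorem add_neg_I_ne_zero_of_im_nonpos {w : ℂ} (h : w.im ≤ 0) : w + -Complex.I ≠ 0 := fun h0 => by
  have := congrArg Complex.im h0
  simp only [Complex.add_im, Complex.neg_im, Complex.I_im, Complex.zero_im] at this
  linarith

theorem isNevanlinnaFamily_scalar (hc : DifferentiableOn ℂ c cutPlane)
    (hconj : ∀ z ∈ cutPlane, c ((starRingEnd ℂ) z) = (starRingEnd ℂ) (c z))
    (him : ∀ z ∈ cutPlane, 0 ≤ z.im → 0 ≤ (c z).im) :
    IsNevanlinnaFamily fun z : nonrealPlane =>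
      LinRel.ofBounded (c z • ContinuousLinearMap.id ℂ M) where
  maximal_dissipative z hz :=
    LinRel.maximal_isDissipative_ofBounded (him z (nonrealPlane_subset_cutPlane z.2) hz.le)
  maximal_accumulative z hz := LinRel.maximal_isAccumulative_ofBounded
    (im_nonpos_of_conj hconj him (nonrealPlane_subset_cutPlane z.2) hz.le)
  adjoint_eq z := by
    rw [LinRel.adjoint_ofBounded_smul_id, hconj z (nonrealPlane_subset_cutPlane z.2)]
  holomorphic_upper := ⟨Complex.I, by simp, hasHolomorphicResolventOn_scalar hc
    (fun _ hz => Or.inl (ne_of_gt hz))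
    fun z hz => add_I_ne_zero_of_im_nonneg (him z (Or.inl (ne_of_gt hz)) (le_of_lt hz))⟩
  holomorphic_lower := ⟨-Complex.I, by simp, hasHolomorphicResolventOn_scalar hc
    (fun _ hz => Or.inl (ne_of_lt hz))
    fun z hz => add_neg_I_ne_zero_of_im_nonpos
      (im_nonpos_of_conj hconj him (Or.inl (ne_of_lt hz)) (le_of_lt hz))⟩

theorem continuesToNegativeAxis_scalar (hc : DifferentiableOn ℂ c cutPlane)
    (hconj : ∀ z ∈ cutPlane, c ((starRingEnd ℂ) z) = (starRingEnd ℂ) (c z))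
    (him : ∀ z ∈ cutPlane, 0 ≤ z.im → 0 ≤ (c z).im) :
    ContinuesToNegativeAxis fun z : cutPlane =>
      LinRel.ofBounded (c z • ContinuousLinearMap.id ℂ M) :=
  ⟨⟨Complex.I, by simp, hasHolomorphicResolventOn_scalar hc (fun _ hz => hz.1)
    fun z hz => add_I_ne_zero_of_im_nonneg (him z hz.1 hz.2)⟩,
  ⟨-Complex.I, by simp, hasHolomorphicResolventOn_scalar hc (fun _ hz => hz.1)
    fun _ hz => add_neg_I_ne_zero_of_im_nonpos (im_nonpos_of_conj hconj him hz.1 hz.2)⟩⟩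

end ScalarFamilies

/-! ### The scalar functions `i/√z` and `i√z` -/

theorem differentiableOn_I_div_cutSqrt :
    DifferentiableOn ℂ (fun z => Complex.I / cutSqrt z) cutPlane :=
  (differentiableOn_const _).div differentiableOn_cutSqrt fun _ hz => cutSqrt_ne_zero hz

theorem differentiableOn_I_mul_cutSqrt :
    DifferentiableOn ℂ (fun z => Complex.I * cutSqrt z) cutPlane :=
  differentiableOn_cutSqrt.const_mul _

theorem I_div_cutSqrt_sq (z : ℂ) : -z⁻¹ = (Complex.I / cutSqrt z) ^ 2 := by
  rw [div_pow, cutSqrt_sq, Complex.I_sq, neg_div, one_div]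

theorem I_mul_cutSqrt_sq (z : ℂ) : -z = (Complex.I * cutSqrt z) ^ 2 := by
  rw [mul_pow, cutSqrt_sq, Complex.I_sq, neg_one_mul]

theorem I_div_cutSqrt_of_im_eq_zero {z : ℂ} (hz : z ∈ cutPlane) (h : z.im = 0) :
    Complex.I / cutSqrt z = (((cutSqrt z).im⁻¹ : ℝ) : ℂ) := by
  have h0 : ((cutSqrt z).im : ℂ) ≠ 0 := by exact_mod_cast (cutSqrt_im_pos hz).ne'
  conv_lhs => rw [cutSqrt_eq_of_im_eq_zero hz h]
  rw [Complex.ofReal_inv]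
  field_simp

theorem I_mul_cutSqrt_of_im_eq_zero {z : ℂ} (hz : z ∈ cutPlane) (h : z.im = 0) :
    Complex.I * cutSqrt z = ((-(cutSqrt z).im : ℝ) : ℂ) := by
  conv_lhs => rw [cutSqrt_eq_of_im_eq_zero hz h]
  rw [mul_left_comm, Complex.I_mul_I, mul_neg_one, Complex.ofReal_neg]

theorem I_div_cutSqrt_im (z : ℂ) :
    (Complex.I / cutSqrt z).im = (cutSqrt z).re / Complex.normSq (cutSqrt z) := by
  simp [Complex.div_im]

theorem cutSqrt_neg_one : cutSqrt (-1) = Complex.I := by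
  simp [cutSqrt]

theorem I_div_cutSqrt_conj {z : ℂ} (hz : z ∈ cutPlane) :
    Complex.I / cutSqrt ((starRingEnd ℂ) z) = (starRingEnd ℂ) (Complex.I / cutSqrt z) := by
  rw [cutSqrt_conj hz, map_div₀, Complex.conj_I, div_neg, neg_div]

theorem I_mul_cutSqrt_conj {z : ℂ} (hz : z ∈ cutPlane) :
    Complex.I * cutSqrt ((starRingEnd ℂ) z) = (starRingEnd ℂ) (Complex.I * cutSqrt z) := by
  rw [cutSqrt_conj hz, map_mul, Complex.conj_I, mul_neg, neg_mul]

theorem I_div_cutSqrt_im_nonneg {z : ℂ} (hz : z ∈ cutPlane) (h : 0 ≤ z.im) :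
    0 ≤ (Complex.I / cutSqrt z).im := by
  rw [I_div_cutSqrt_im]
  exact div_nonneg (cutSqrt_re_nonneg hz h) (Complex.normSq_nonneg _)

theorem I_mul_cutSqrt_im_nonneg {z : ℂ} (hz : z ∈ cutPlane) (h : 0 ≤ z.im) :
    0 ≤ (Complex.I * cutSqrt z).im := by
  rw [Complex.I_mul_im]
  exact cutSqrt_re_nonneg hz h

/-! ### Existence and uniqueness of the fixed points -/

section FixedPoints

variable (M : Type*) [NormedAddCommGroup M] [InnerProductSpace ℂ M]

theorem isStieltjesFamily_Q0 : IsStieltjesFamily (Q0 M) where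
  nevanlinna := isNevanlinnaFamily_scalar (c := fun z => Complex.I / cutSqrt z)
    differentiableOn_I_div_cutSqrt
    (fun _ => I_div_cutSqrt_conj) fun _ => I_div_cutSqrt_im_nonneg
  nonneg z hz p hp := by
    rw [LinRel.inner_im_of_mem_ofBounded_smul_id hp, LinRel.inner_re_of_mem_ofBounded_smul_id hp,
      I_div_cutSqrt_of_im_eq_zero z.2 hz, Complex.ofReal_im, Complex.ofReal_re]
    have := cutSqrt_im_pos z.2
    exact ⟨zero_mul _, mul_nonneg (inv_nonneg.mpr this.le) (sq_nonneg _)⟩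
  continuation := continuesToNegativeAxis_scalar (c := fun z => Complex.I / cutSqrt z)
    differentiableOn_I_div_cutSqrt
    (fun _ => I_div_cutSqrt_conj) fun _ => I_div_cutSqrt_im_nonneg

theorem isInverseStieltjesFamily_R0 : IsInverseStieltjesFamily (R0 M) where
  nevanlinna := isNevanlinnaFamily_scalar (c := fun z => Complex.I * cutSqrt z)
    differentiableOn_I_mul_cutSqrt
    (fun _ => I_mul_cutSqrt_conj) fun _ => I_mul_cutSqrt_im_nonneg
  nonpos z hz p hp := by
    rw [LinRel.inner_im_of_mem_ofBounded_smul_id hp, LinRel.inner_re_of_mem_ofBounded_smul_id hp,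
      I_mul_cutSqrt_of_im_eq_zero z.2 hz, Complex.ofReal_im, Complex.ofReal_re]
    have := cutSqrt_im_pos z.2
    exact ⟨zero_mul _, mul_nonpos_of_nonpos_of_nonneg (by linarith) (by positivity)⟩
  continuation := continuesToNegativeAxis_scalar (c := fun z => Complex.I * cutSqrt z)
    differentiableOn_I_mul_cutSqrt
    (fun _ => I_mul_cutSqrt_conj) fun _ => I_mul_cutSqrt_im_nonneg

theorem isFixedPt_phiPlus_Q0 : Function.IsFixedPt phiPlus (Q0 M) := funext fun z =>
  LinRel.scale_inv_ofBounded_smul_id (div_ne_zero Complex.I_ne_zero (cutSqrt_ne_zero z.2))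
    (I_div_cutSqrt_sq z)

theorem isFixedPt_phiMinus_R0 : Function.IsFixedPt phiMinus (R0 M) := funext fun z =>
  LinRel.scale_inv_ofBounded_smul_id (mul_ne_zero Complex.I_ne_zero (cutSqrt_ne_zero z.2))
    (I_mul_cutSqrt_sq z)

variable {M}

theorem IsStieltjesFamily.eq_Q0 [CompleteSpace M] {Q : cutPlane → LinRel M} (hQ : IsStieltjesFamily Q)
    (hfix : Function.IsFixedPt phiPlus Q) : Q = Q0 M := by
  refine funext (eq_ofBounded_of_continuesToNegativeAxis differentiableOn_I_div_cutSqrt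
    (fun z hz => ?_) hQ.continuation)
  refine LinRel.le_ofBounded_of_isNonneg (I_div_cutSqrt_sq z) (congrFun hfix z) (hQ.nonneg z hz) ?_
  rw [I_div_cutSqrt_of_im_eq_zero z.2 hz, Complex.ofReal_re]
  exact inv_pos.mpr (cutSqrt_im_pos z.2)

theorem IsInverseStieltjesFamily.eq_R0 [CompleteSpace M] {R : cutPlane → LinRel M}
    (hR : IsInverseStieltjesFamily R)
    (hfix : Function.IsFixedPt phiMinus R) : R = R0 M := by
  refine funext (eq_ofBounded_of_continuesToNegativeAxis differentiableOn_I_mul_cutSqrt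
    (fun z hz => ?_) hR.continuation)
  refine LinRel.le_ofBounded_of_isNonpos (I_mul_cutSqrt_sq z) (congrFun hfix z) (hR.nonpos z hz) ?_
  rw [I_mul_cutSqrt_of_im_eq_zero z.2 hz, Complex.ofReal_re]
  exact neg_neg_of_pos (cutSqrt_im_pos z.2)

end FixedPoints

end StieltjesFamilies

open StieltjesFamilies in
theorem proposition4p7 (M : Type*) [NormedAddCommGroup M] [InnerProductSpace ℂ M]
    [CompleteSpace M] :
    ({Q : cutPlane → LinRel M | IsStieltjesFamily Q ∧ Function.IsFixedPt phiPlus Q} = {Q0 M} ∧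
      Q0 M ⟨-1, neg_one_mem_cutPlane⟩ = LinRel.ofBounded (ContinuousLinearMap.id ℂ M)) ∧
    ({R : cutPlane → LinRel M | IsInverseStieltjesFamily R ∧ Function.IsFixedPt phiMinus R} =
        {R0 M} ∧
      R0 M ⟨-1, neg_one_mem_cutPlane⟩ = LinRel.ofBounded (-ContinuousLinearMap.id ℂ M)) := by
  refine ⟨⟨?_, ?_⟩, ?_, ?_⟩
  · exact Set.eq_singleton_iff_unique_mem.mpr
      ⟨⟨isStieltjesFamily_Q0 M, isFixedPt_phiPlus_Q0 M⟩, fun _ hQ => hQ.1.eq_Q0 hQ.2⟩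
  · rw [Q0, cutSqrt_neg_one, div_self Complex.I_ne_zero, one_smul]
  · exact Set.eq_singleton_iff_unique_mem.mpr
      ⟨⟨isInverseStieltjesFamily_R0 M, isFixedPt_phiMinus_R0 M⟩, fun _ hR => hR.1.eq_R0 hR.2⟩
  · rw [R0, cutSqrt_neg_one, Complex.I_mul_I, neg_one_smul]
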